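/- For $\tau$ in the upper half-plane let $X_\tau=\mathbb C/\Lambda_\tau$ with $\Lambda_\tau=\mathbb Z+\mathbb Z\tau$; it is a Riemann surface of genus $1$, and $\tau$ is considered modulo the action of $\mathrm{SL}_2(\mathbb Z)$. A complex affine (resp. projective) structure is a maximal atlas of charts with values in $\mathbb C$ (resp. $\mathbb{CP}^1$) whose transition functions are locally restrictions of maps $z\mapsto az+b$, $a\neq0$ (resp. of Möbius transformations). Let $\mathcal A(X_\tau)$ be the set of complex affine structures on $X_\tau$ whose underlying complex structure is that of $X_\tau$; the Euclidean uniformization is the one whose atlas is generated by the local inverses of $\mathbb C\to X_\tau$. Every $\sigma\in\mathcal A(X_\tau)$ is regarded as a complex projective structure via $\mathbb C\subset\mathbb{CP}^1$, and $\sigma$ is called a relatively Hurwitz projective structure if the group of homeomorphisms of $X_\tau$ that are given locally by Möbius transformations in its projective charts is equal to the group $\mathrm{Aut}(X_\tau)$ of holomorphic automorphisms of $X_\tau$. For every $\tau$ the following are equivalent: 1. the class of $\tau$ modulo $\mathrm{SL}_2(\mathbb Z)$ is the class of $e^{2\pi i/3}$ or of $e^{i\pi/2}$; 2. the Euclidean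 uniformization of $X_\tau$ is relatively Hurwitz, and it is the unique relatively Hurwitz projective structure in $\mathcal A(X_\tau)$; 3. $X_\tau$ has an extra automorphism given by complex multiplication, i.e. there are $a\in\mathbb C\setminus\{1,-1\}$ and $f\in\mathrm{Aut}(X_\tau)$ with $f([z])=[az]$ for all $z\in\mathbb C$. -/

import Mathlib

open Set Filter Topology Manifold ContDiff

noncomputable section

namespace Unif

/-! ### Maximal atlases -/

section GStructure

variable {H : Type*} [TopologicalSpace H]

/-- The pseudogroup on `H` of all local homeomorphisms that agree, near every point of their
source, with an element of the transformation group `Γ`. -/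
def localGroupoid (Γ : Subgroup (Equiv.Perm H)) : StructureGroupoid H where
  members := {e | ∀ x ∈ e.source, ∃ g ∈ Γ, ∀ᶠ y in 𝓝 x, e y = g y}
  trans' := by
    intro e e' he he' x hx
    rw [OpenPartialHomeomorph.trans_source] at hx
    obtain ⟨g, hg, h⟩ := he x hx.1
    obtain ⟨g', hg', h'⟩ := he' (e x) hx.2
    refine ⟨g' * g, mul_mem hg' hg, ?_⟩
    filter_upwards [h, (e.continuousAt hx.1).eventually h'] with y hy hy'
    simp only [OpenPartialHomeomorph.coe_trans, Function.comp_apply, Equiv.Perm.mul_apply]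
    rw [hy', hy]
  symm' := by
    intro e he x hx
    have hx' : x ∈ e.target := hx
    obtain ⟨g, hg, h⟩ := he (e.symm x) (e.map_target hx')
    refine ⟨g⁻¹, inv_mem hg, ?_⟩
    filter_upwards [(e.symm.continuousAt hx).eventually h, e.open_target.mem_nhds hx'] with y hy hy'
    rw [e.right_inv hy'] at hy
    exact (Equiv.Perm.inv_eq_iff_eq.2 hy).symm
  id_mem' := fun x _ => ⟨1, one_mem _, by simp⟩
  locality' := by
    intro e h x hx
    obtain ⟨s, hs, hxs, h'⟩ := h x hx
    exact h' x (by rw [e.restr_source' s hs]; exact ⟨hx, hxs⟩)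
  mem_of_eqOnSource' := by
    intro e e' he hee' x hx
    obtain ⟨g, hg, h⟩ := he x (hee'.1 ▸ hx)
    refine ⟨g, hg, ?_⟩
    filter_upwards [h, e'.open_source.mem_nhds hx] with y hy hy'
    rw [hee'.2 hy', hy]

/-- A geometric structure on `X` modelled on the pseudogroup `G`: a maximal atlas of charts with
values in `H` whose transition functions belong to `G`. -/
@[ext]
structure GStructure (G : StructureGroupoid H) (X : Type*) [TopologicalSpace X] where
  charts : Set (OpenPartialHomeomorph X H)
  cover : ∀ x : X, ∃ e ∈ charts, x ∈ e.source
  compatible : ∀ e ∈ charts, ∀ e' ∈ charts, e.symm ≫ₕ e' ∈ G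
  maximal : ∀ e : OpenPartialHomeomorph X H, (∀ e' ∈ charts, e'.symm ≫ₕ e ∈ G) → e ∈ charts

variable {X : Type*} [TopologicalSpace X]

/-- The unique structure whose maximal atlas contains the given atlas `A`. -/
def GStructure.generate (G : StructureGroupoid H) (A : Set (OpenPartialHomeomorph X H))
    (cover : ∀ x : X, ∃ e ∈ A, x ∈ e.source)
    (compatible : ∀ e ∈ A, ∀ e' ∈ A, e.symm ≫ₕ e' ∈ G) : GStructure G X where
  charts := {e | ∀ e' ∈ A, e'.symm ≫ₕ e ∈ G}
  cover := fun x => by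
    obtain ⟨e, he, hx⟩ := cover x
    exact ⟨e, fun e' he' => compatible e' he' e he, hx⟩
  compatible := by
    intro e he e' he'
    let inst : ChartedSpace H X :=
      { atlas := A
        chartAt := fun x => (cover x).choose
        mem_chart_source := fun x => (cover x).choose_spec.2
        chart_mem_atlas := fun x => (cover x).choose_spec.1 }
    have key : ∀ c : OpenPartialHomeomorph X H, (∀ c' ∈ A, c'.symm ≫ₕ c ∈ G) →
        c ∈ G.maximalAtlas X := by
      intro c hc c' hc'
      have h := hc c' hc'
      have h2 := G.symm h
      rw [OpenPartialHomeomorph.trans_symm_eq_symm_trans_symm,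
        OpenPartialHomeomorph.symm_symm] at h2
      exact ⟨h2, h⟩
    exact StructureGroupoid.compatible_of_mem_maximalAtlas (key e he) (key e' he')
  maximal := fun e h e' he' => h e' fun e'' he'' => compatible e'' he'' e' he'

/-- The group of automorphisms of a geometric structure: the homeomorphisms of `X` which, read in
the charts of the structure, belong to the pseudogroup. -/
def GStructure.aut {G : StructureGroupoid H} (σ : GStructure G X) : Subgroup (X ≃ₜ X) where
  carrier := {f | ∀ e ∈ σ.charts, ∀ e' ∈ σ.charts,
    e.symm ≫ₕ f.toOpenPartialHomeomorph ≫ₕ e' ∈ G}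
  one_mem' := by
    intro e he e' he'
    change e.symm ≫ₕ OpenPartialHomeomorph.refl X ≫ₕ e' ∈ G
    rw [OpenPartialHomeomorph.refl_trans]
    exact σ.compatible e he e' he'
  mul_mem' := by
    intro f g hf hg
    let inst : ChartedSpace H X :=
      { atlas := σ.charts
        chartAt := fun x => (σ.cover x).choose
        mem_chart_source := fun x => (σ.cover x).choose_spec.2
        chart_mem_atlas := fun x => (σ.cover x).choose_spec.1 }
    let F : Structomorph G X X := ⟨f, fun c c' hc hc' => hf c hc c' hc'⟩
    let K : Structomorph G X X := ⟨g, fun c c' hc hc' => hg c hc c' hc'⟩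
    intro e he e' he'
    exact (K.trans F).mem_groupoid e e' he he'
  inv_mem' := by
    intro f hf e he e' he'
    have h := G.symm (hf e' he' e he)
    rw [OpenPartialHomeomorph.trans_symm_eq_symm_trans_symm,
      OpenPartialHomeomorph.trans_symm_eq_symm_trans_symm, OpenPartialHomeomorph.symm_symm,
      OpenPartialHomeomorph.trans_assoc] at h
    exact h

end GStructure

/-! ### Affine and projective structures -/

/-- The group of affine transformations `z ↦ a z + b` of `ℂ`, with `a ≠ 0`. -/
def affineGroup : Subgroup (Equiv.Perm ℂ) where
  carrier := {g | ∃ a b : ℂ, a ≠ 0 ∧ ∀ z, g z = a * z + b}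
  one_mem' := ⟨1, 0, one_ne_zero, by simp⟩
  mul_mem' := by
    rintro f g ⟨a, b, ha, hf⟩ ⟨c, d, hc, hg⟩
    refine ⟨a * c, a * d + b, mul_ne_zero ha hc, fun z => ?_⟩
    rw [Equiv.Perm.mul_apply, hg, hf]
    ring
  inv_mem' := by
    rintro f ⟨a, b, ha, hf⟩
    refine ⟨a⁻¹, -a⁻¹ * b, inv_ne_zero ha, fun z => ?_⟩
    rw [Equiv.Perm.inv_eq_iff_eq, hf]
    field_simp
    ring

/-- The Riemann sphere `ℂ ∪ {∞}`. -/
abbrev Sphere : Type := OnePoint ℂ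

/-- The group of Möbius transformations of the Riemann sphere, i.e. the image of `GL₂(ℂ)`, which
is also the image of `SL₂(ℂ)` and is isomorphic to `PSL₂(ℂ)`. -/
def moebiusGroup : Subgroup (Equiv.Perm Sphere) :=
  (MulAction.toPermHom (GL (Fin 2) ℂ) Sphere).range

/-- A complex affine structure. -/
abbrev AffineStructure (X : Type*) [TopologicalSpace X] : Type _ :=
  GStructure (localGroupoid affineGroup) X

/-- A complex projective structure. -/
abbrev ProjectiveStructure (X : Type*) [TopologicalSpace X] : Type _ :=
  GStructure (localGroupoid moebiusGroup) X

/-- The affine patch `ℂ ⊆ ℂ ∪ {∞}`. -/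
def patch : OpenPartialHomeomorph ℂ Sphere :=
  (OnePoint.isOpenEmbedding_coe (X := ℂ)).toOpenPartialHomeomorph _

/-- Every affine transformation extends to a Möbius transformation. -/
theorem exists_moebius_of_affine {g : Equiv.Perm ℂ} (hg : g ∈ affineGroup) :
    ∃ m ∈ moebiusGroup, ∀ z : ℂ, m (z : Sphere) = (g z : ℂ) := by
  obtain ⟨a, b, ha, h⟩ := hg
  let M : GL (Fin 2) ℂ := Matrix.GeneralLinearGroup.mkOfDetNeZero !![a, b; 0, 1] (by simpa)
  refine ⟨_, ⟨M, rfl⟩, fun z => ?_⟩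
  rw [MulAction.toPermHom_apply, MulAction.toPerm_apply, OnePoint.smul_some_eq_ite, h]
  simp [M, Matrix.GeneralLinearGroup.mkOfDetNeZero]

variable {X : Type*} [TopologicalSpace X]

/-- The projective structure underlying an affine structure: its maximal atlas is generated by the
affine charts, seen as charts with values in `ℂ ⊆ ℂ ∪ {∞}`. -/
def toProjective (σ : AffineStructure X) : ProjectiveStructure X :=
  GStructure.generate _ ((fun e => e ≫ₕ patch) '' σ.charts)
    (fun x => by
      obtain ⟨e, he, hx⟩ := σ.cover x
      exact ⟨_, ⟨e, he, rfl⟩, by simpa [patch] using hx⟩)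
    (by
      rintro _ ⟨e, he, rfl⟩ _ ⟨e', he', rfl⟩ x hx
      have hx1 : x ∈ patch.target := by
        simp only [OpenPartialHomeomorph.trans_source, OpenPartialHomeomorph.symm_source,
          OpenPartialHomeomorph.trans_target] at hx
        exact hx.1.1
      obtain ⟨z, -, rfl⟩ := patch.image_source_eq_target ▸ hx1
      have hz : patch.symm (patch z) = z := patch.left_inv (by simp [patch])
      have hze : z ∈ (e.symm ≫ₕ e').source := by
        simp only [OpenPartialHomeomorph.trans_source, OpenPartialHomeomorph.symm_source,
          mem_inter_iff, mem_preimage,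
          OpenPartialHomeomorph.trans_symm_eq_symm_trans_symm,
          OpenPartialHomeomorph.coe_trans, Function.comp_apply, hz] at hx ⊢
        exact ⟨hx.1.2, hx.2.1⟩
      obtain ⟨g, hg, h⟩ := σ.compatible e he e' he' z hze
      obtain ⟨m, hm, hmg⟩ := exists_moebius_of_affine hg
      refine ⟨m, hm, ?_⟩
      have hnhds : 𝓝 (patch z) = Filter.map patch (𝓝 z) :=
        (patch.map_nhds_eq (by simp [patch])).symm
      rw [hnhds, Filter.eventually_map]
      filter_upwards [h] with w hw
      have hw' : patch.symm (patch w) = w := patch.left_inv (by simp [patch])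
      simp only [OpenPartialHomeomorph.trans_symm_eq_symm_trans_symm,
        OpenPartialHomeomorph.coe_trans, Function.comp_apply, hw'] at hw ⊢
      rw [hw]
      exact (hmg w).symm)

/-- The group of projective automorphisms of a projective structure. -/
abbrev moeb (σ : ProjectiveStructure X) : Subgroup (X ≃ₜ X) := σ.aut

/-! ### Riemann surfaces -/

/-- The group of holomorphic automorphisms of a Riemann surface. -/
def holAut (X : Type*) [TopologicalSpace X] [ChartedSpace ℂ X] : Subgroup (X ≃ₜ X) where
  carrier := {f | MDifferentiable 𝓘(ℂ) 𝓘(ℂ) f ∧ MDifferentiable 𝓘(ℂ) 𝓘(ℂ) f.symm}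
  one_mem' := ⟨mdifferentiable_id, mdifferentiable_id⟩
  mul_mem' := fun {_ _} hf hg => ⟨hf.1.comp hg.1, hg.2.comp hf.2⟩
  inv_mem' := fun {_} hf => ⟨hf.2, hf.1⟩

/-- The space `𝒜(X)` of complex affine structures on the Riemann surface `X`: those whose charts
are holomorphic charts of `X`, so that the underlying complex structure is that of `X`. -/
def affineStructures (X : Type*) [TopologicalSpace X] [ChartedSpace ℂ X] :
    Set (AffineStructure X) :=
  {σ | σ.charts ⊆ IsManifold.maximalAtlas 𝓘(ℂ) ω X}

/-- A projective structure with underlying Riemann surface `X` is relatively Hurwitz if its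
projective automorphisms are exactly the holomorphic automorphisms of `X`. -/
def IsRelativelyHurwitz [ChartedSpace ℂ X] (σ : ProjectiveStructure X) : Prop :=
  moeb σ = holAut X

/-! ### The torus `X_τ = ℂ / (ℤ + ℤ τ)` -/

/-- The lattice `Λ_τ` spanned by `1` and `τ`. -/
def lattice (τ : UpperHalfPlane) : AddSubgroup ℂ := AddSubgroup.closure {1, (τ : ℂ)}

/-- The periods `1` and `τ`. -/
def periodPair (τ : UpperHalfPlane) : PeriodPair where
  ω₁ := 1
  ω₂ := τ
  indep := by
    rw [LinearIndependent.pair_iff]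
    intro s t h
    have him := congrArg Complex.im h
    have hre := congrArg Complex.re h
    have ht : t = 0 := by simpa [τ.im_ne_zero] using him
    subst ht
    exact ⟨by simpa using hre, rfl⟩

theorem lattice_eq (τ : UpperHalfPlane) : lattice τ = (periodPair τ).lattice.toAddSubgroup := by
  rw [PeriodPair.lattice, Submodule.span_int_eq_addSubgroupClosure]
  rfl

instance (τ : UpperHalfPlane) : DiscreteTopology (lattice τ) := by
  rw [lattice_eq]
  exact inferInstanceAs (DiscreteTopology (periodPair τ).lattice)

/-- The complex torus `X_τ = ℂ / Λ_τ`. -/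
abbrev Torus (τ : UpperHalfPlane) : Type := ℂ ⧸ lattice τ

/-- The quotient map `ℂ → X_τ`. -/
abbrev proj (τ : UpperHalfPlane) (z : ℂ) : Torus τ := (z : ℂ ⧸ lattice τ)

theorem isLocalHomeomorph_proj (τ : UpperHalfPlane) : IsLocalHomeomorph (proj τ) := by
  have h := AddSubgroup.isAddQuotientCoveringMap_of_comm (lattice τ)
    ⟨inferInstanceAs (DiscreteTopology (lattice τ))⟩
  exact h.isCoveringMap.isLocalHomeomorph

/-- The local inverses of the quotient map `ℂ → X_τ`. -/
def euclideanAtlas (τ : UpperHalfPlane) : Set (OpenPartialHomeomorph (Torus τ) ℂ) :=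
  {e | ⇑e.symm = proj τ}

theorem euclideanAtlas_cover (τ : UpperHalfPlane) (x : Torus τ) :
    ∃ e ∈ euclideanAtlas τ, x ∈ e.source := by
  obtain ⟨z, rfl⟩ := QuotientAddGroup.mk_surjective x
  obtain ⟨e, hz, he⟩ := isLocalHomeomorph_proj τ z
  refine ⟨e.symm, he.symm, ?_⟩
  have := e.map_source hz
  rwa [← he] at this

theorem euclideanAtlas_compatible (τ : UpperHalfPlane) :
    ∀ e ∈ euclideanAtlas τ, ∀ e' ∈ euclideanAtlas τ, ∀ z ∈ (e.symm ≫ₕ e').source,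
      ∃ b : ℂ, ∀ᶠ w in 𝓝 z, (e.symm ≫ₕ e') w = w + b := by
  intro e he e' he' z hz
  have hmem : ∀ w ∈ (e.symm ≫ₕ e').source, (e.symm ≫ₕ e') w - w ∈ lattice τ := by
    intro w hw
    rw [OpenPartialHomeomorph.trans_source] at hw
    have h1 : e'.symm (e' (e.symm w)) = e.symm w := e'.left_inv hw.2
    have h2 : proj τ (e' (e.symm w)) = proj τ w :=
      (congrFun he' _).symm.trans (h1.trans (congrFun he w))
    have h3 := QuotientAddGroup.eq.1 h2.symm
    rw [OpenPartialHomeomorph.coe_trans, Function.comp_apply, sub_eq_neg_add]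
    exact h3
  obtain ⟨U, hU, hU0⟩ : ∃ U ∈ 𝓝 (0 : ℂ), ∀ u ∈ U, u ∈ lattice τ → u = 0 := by
    have h : ({0} : Set (lattice τ)) ∈ 𝓝 0 := (isOpen_discrete _).mem_nhds rfl
    rw [nhds_subtype_eq_comap, Filter.mem_comap] at h
    obtain ⟨U, hU, h⟩ := h
    exact ⟨U, hU, fun u hu hl => congrArg Subtype.val (h (show (⟨u, hl⟩ : lattice τ).1 ∈ U from hu))⟩
  refine ⟨(e.symm ≫ₕ e') z - z, ?_⟩
  have hcont : Tendsto (fun w => ((e.symm ≫ₕ e') w - w) - ((e.symm ≫ₕ e') z - z)) (𝓝 z) (𝓝 0) := by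
    have h := (((e.symm ≫ₕ e').continuousAt hz).sub continuousAt_id).sub
      (continuousAt_const (y := (e.symm ≫ₕ e') z - z))
    have h' : Tendsto _ (𝓝 z) (𝓝 _) := h
    convert h' using 2 <;> simp
  filter_upwards [hcont hU, (e.symm ≫ₕ e').open_source.mem_nhds hz] with w hw hw'
  have h0 := hU0 _ hw (sub_mem (hmem w hw') (hmem z hz))
  linear_combination h0

/-- The complex structure of `X_τ`: the one for which the quotient map `ℂ → X_τ` is locally
biholomorphic. -/
instance (τ : UpperHalfPlane) : ChartedSpace ℂ (Torus τ) where
  atlas := euclideanAtlas τ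
  chartAt x := (euclideanAtlas_cover τ x).choose
  mem_chart_source x := (euclideanAtlas_cover τ x).choose_spec.2
  chart_mem_atlas x := (euclideanAtlas_cover τ x).choose_spec.1

instance (τ : UpperHalfPlane) : IsManifold 𝓘(ℂ) ω (Torus τ) :=
  isManifold_of_contDiffOn _ _ _ (by
    intro e e' he he'
    simp only [modelWithCornersSelf_coe, modelWithCornersSelf_coe_symm, Function.comp_id,
      Function.id_comp, preimage_id, range_id, inter_univ]
    intro z hz
    obtain ⟨b, hb⟩ := euclideanAtlas_compatible τ e he e' he' z hz
    exact ((contDiffAt_id.add contDiffAt_const).congr_of_eventuallyEq hb).contDiffWithinAt)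

/-- The Euclidean uniformization of `X_τ`: the affine structure coming from the identification
of `X_τ` with the quotient of `ℂ` by the group of translations `Λ_τ`. -/
def euclideanUniformization (τ : UpperHalfPlane) : AffineStructure (Torus τ) :=
  GStructure.generate _ (euclideanAtlas τ) (euclideanAtlas_cover τ) (by
    intro e he e' he' z hz
    obtain ⟨b, hb⟩ := euclideanAtlas_compatible τ e he e' he' z hz
    refine ⟨Equiv.addRight b, ⟨1, b, one_ne_zero, fun w => by simp⟩, ?_⟩
    filter_upwards [hb] with w hw
    simp [hw])

end Unif

end

noncomputable section

namespace Unif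

/-! ### Charts and automorphisms tested on germs -/

section GStructure

variable {H X : Type*} [TopologicalSpace H] [TopologicalSpace X]

/-! Read an affine chart on the universal cover as a function `φ` of `w`. The quantity `φ''/φ'` does
not change under affine changes of chart, so it glues to an entire `Λ_τ`-periodic function, which by
Liouville is a constant `c`. If `c = 0` the structure is Euclidean; otherwise every chart is locally
`α exp (c w) + β`.

Holomorphic automorphisms of `X_τ` lift to `z ↦ a z + b` with `a Λ_τ = Λ_τ`. All of them are affine
for the Euclidean structure, which is therefore always relatively Hurwitz. For the structure
developed by `exp`, translations act as dilations and `a = -1` as an inversion, so it is a second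
relatively Hurwitz structure when `±1` are the only units (`isRelativelyHurwitz_expStructure`).
Conversely, if `a ≠ ±1` acts projectively on a structure with `c ≠ 0`, a Möbius transformation
relates `exp (c w)` and `exp (c a w)`, contradicting linear independence of exponentials
(`false_of_moebius_exp`). Uniqueness thus amounts to the existence of a unit `a ≠ ±1`, that is, to a
stabilizer of `τ` in `SL₂(ℤ)` larger than `±1`, which singles out the two elliptic orbits. -/

theorem symm_trans_mem_localGroupoid_iff {Γ : Subgroup (Equiv.Perm H)}
    {e e' : OpenPartialHomeomorph X H} :
    e.symm ≫ₕ e' ∈ localGroupoid Γ ↔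
      ∀ x ∈ e.source, x ∈ e'.source → ∃ g ∈ Γ, ∀ᶠ y in 𝓝 x, e' y = g (e y) := by
  constructor
  · intro h x hx hx'
    obtain ⟨g, hg, hgx⟩ := h (e x) (by simp [hx, hx'])
    refine ⟨g, hg, ?_⟩
    filter_upwards [(e.continuousAt hx).eventually hgx, e.open_source.mem_nhds hx] with y hy hys
    simpa [e.left_inv hys] using hy
  · intro h x hx
    simp only [OpenPartialHomeomorph.trans_source, OpenPartialHomeomorph.symm_source,
      mem_inter_iff, mem_preimage] at hx
    obtain ⟨g, hg, hgx⟩ := h (e.symm x) (e.map_target hx.1) hx.2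
    refine ⟨g, hg, ?_⟩
    filter_upwards [(e.symm.continuousAt hx.1).eventually hgx, e.open_target.mem_nhds hx.1]
      with y hy hys
    simpa [e.right_inv hys] using hy

theorem symm_trans_homeomorph_trans_mem_localGroupoid_iff {Γ : Subgroup (Equiv.Perm H)}
    {e e' : OpenPartialHomeomorph X H} {f : X ≃ₜ X} :
    e.symm ≫ₕ f.toOpenPartialHomeomorph ≫ₕ e' ∈ localGroupoid Γ ↔
      ∀ x ∈ e.source, f x ∈ e'.source → ∃ g ∈ Γ, ∀ᶠ y in 𝓝 x, e' (f y) = g (e y) := by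
  rw [symm_trans_mem_localGroupoid_iff]
  simp

theorem GStructure.subset_generate (G : StructureGroupoid H)
    (A : Set (OpenPartialHomeomorph X H)) (cover : ∀ x : X, ∃ e ∈ A, x ∈ e.source)
    (compatible : ∀ e ∈ A, ∀ e' ∈ A, e.symm ≫ₕ e' ∈ G) :
    A ⊆ (GStructure.generate G A cover compatible).charts :=
  fun e he e' he' => compatible e' he' e he

/-- Maximality of the smaller atlas absorbs every chart compatible with it, so one inclusion
suffices to identify two structures. -/
theorem GStructure.eq_of_charts_subset {G : StructureGroupoid H} {σ σ' : GStructure G X}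
    (h : σ.charts ⊆ σ'.charts) : σ = σ' := by
  refine GStructure.ext (h.antisymm fun e he => σ.maximal e fun e' he' => ?_)
  exact σ'.compatible e' (h he') e he

/-- Automorphisms of a structure can be tested on one pair of charts at each point. -/
theorem GStructure.mem_aut_of_exists {Γ : Subgroup (Equiv.Perm H)}
    {σ : GStructure (localGroupoid Γ) X} {f : X ≃ₜ X}
    (h : ∀ x, ∃ e ∈ σ.charts, ∃ e' ∈ σ.charts, x ∈ e.source ∧ f x ∈ e'.source ∧
      ∃ g ∈ Γ, ∀ᶠ y in 𝓝 x, e' (f y) = g (e y)) : f ∈ σ.aut := by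
  intro c hc c' hc'
  rw [symm_trans_homeomorph_trans_mem_localGroupoid_iff]
  intro x hx hfx
  obtain ⟨e, he, e', he', hxe, hxe', g, hg, hgx⟩ := h x
  obtain ⟨k, hk, hkx⟩ := symm_trans_mem_localGroupoid_iff.1 (σ.compatible c hc e he) x hx hxe
  obtain ⟨l, hl, hlx⟩ :=
    symm_trans_mem_localGroupoid_iff.1 (σ.compatible e' he' c' hc') (f x) hxe' hfx
  refine ⟨l * g * k, mul_mem (mul_mem hl hg) hk, ?_⟩
  filter_upwards [hgx, hkx, f.continuous.continuousAt.eventually hlx] with y h1 h2 h3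
  rw [h3, h1, h2]
  rfl

theorem GStructure.exists_of_mem_aut {Γ : Subgroup (Equiv.Perm H)}
    {σ : GStructure (localGroupoid Γ) X} {f : X ≃ₜ X} (hf : f ∈ σ.aut)
    {e e' : OpenPartialHomeomorph X H} (he : e ∈ σ.charts) (he' : e' ∈ σ.charts) {x : X}
    (hx : x ∈ e.source) (hx' : f x ∈ e'.source) :
    ∃ g ∈ Γ, ∀ᶠ y in 𝓝 x, e' (f y) = g (e y) :=
  symm_trans_homeomorph_trans_mem_localGroupoid_iff.1 (hf e he e' he') x hx hx'

end GStructure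

/-! ### Projective automorphisms in affine charts -/

section Moebius

variable {X : Type*} [TopologicalSpace X]

theorem trans_patch_mem_charts {σ : AffineStructure X} {e : OpenPartialHomeomorph X ℂ}
    (he : e ∈ σ.charts) : e ≫ₕ patch ∈ (toProjective σ).charts :=
  GStructure.subset_generate _ _ _ _ ⟨e, he, rfl⟩

theorem trans_patch_source (e : OpenPartialHomeomorph X ℂ) : (e ≫ₕ patch).source = e.source := by
  simp [patch]

/-- A Möbius transformation is a fractional linear map wherever it takes a finite value. -/
theorem exists_coeff_of_mem_moebiusGroup {m : Equiv.Perm Sphere} (hm : m ∈ moebiusGroup) :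
    ∃ a b c d : ℂ, a * d - b * c ≠ 0 ∧
      ∀ z w : ℂ, m z = w → c * z + d ≠ 0 ∧ w = (a * z + b) / (c * z + d) := by
  obtain ⟨M, rfl⟩ := hm
  refine ⟨M 0 0, M 0 1, M 1 0, M 1 1, ?_, fun z w h => ?_⟩
  · have := M.det_ne_zero
    rwa [Matrix.det_fin_two] at this
  · rw [MulAction.toPermHom_apply, MulAction.toPerm_apply, OnePoint.smul_some_eq_ite] at h
    split_ifs at h with h0
    · exact absurd h (OnePoint.infty_ne_coe _)
    · exact ⟨h0, (OnePoint.coe_injective h).symm⟩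

theorem exists_moebius_of_coeff {a b c d : ℂ} (h : a * d - b * c ≠ 0) :
    ∃ m ∈ moebiusGroup, ∀ z : ℂ, c * z + d ≠ 0 →
      m (z : Sphere) = ((a * z + b) / (c * z + d) : ℂ) := by
  let M : GL (Fin 2) ℂ := Matrix.GeneralLinearGroup.mkOfDetNeZero !![a, b; c, d]
    (by simpa [Matrix.det_fin_two] using h)
  refine ⟨_, ⟨M, rfl⟩, fun z hz => ?_⟩
  rw [MulAction.toPermHom_apply, MulAction.toPerm_apply, OnePoint.smul_some_eq_ite]
  simp [M, Matrix.GeneralLinearGroup.mkOfDetNeZero, hz]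

theorem mem_moeb_of_exists {σ : AffineStructure X} {f : X ≃ₜ X}
    (h : ∀ x, ∃ e ∈ σ.charts, ∃ e' ∈ σ.charts, x ∈ e.source ∧ f x ∈ e'.source ∧
      ∃ m ∈ moebiusGroup, ∀ᶠ y in 𝓝 x, ((e' (f y) : ℂ) : Sphere) = m (e y : ℂ)) :
    f ∈ moeb (toProjective σ) := by
  refine GStructure.mem_aut_of_exists fun x => ?_
  obtain ⟨e, he, e', he', hx, hx', m, hm, h⟩ := h x
  exact ⟨_, trans_patch_mem_charts he, _, trans_patch_mem_charts he',
    by rwa [trans_patch_source], by rwa [trans_patch_source], m, hm, h⟩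

theorem exists_moebius_of_mem_moeb {σ : AffineStructure X} {f : X ≃ₜ X}
    (hf : f ∈ moeb (toProjective σ)) {e e' : OpenPartialHomeomorph X ℂ} (he : e ∈ σ.charts)
    (he' : e' ∈ σ.charts) {x : X} (hx : x ∈ e.source) (hx' : f x ∈ e'.source) :
    ∃ a b c d : ℂ, a * d - b * c ≠ 0 ∧ ∀ᶠ y in 𝓝 x, c * e y + d ≠ 0 ∧
      e' (f y) = (a * e y + b) / (c * e y + d) := by
  obtain ⟨m, hm, h⟩ := GStructure.exists_of_mem_aut hf (trans_patch_mem_charts he)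
    (trans_patch_mem_charts he') (x := x) (by rwa [trans_patch_source])
    (by rwa [trans_patch_source])
  obtain ⟨a, b, c, d, h0, hm⟩ := exists_coeff_of_mem_moebiusGroup hm
  refine ⟨a, b, c, d, h0, h.mono fun y hy => hm _ _ hy.symm⟩

/-- Locally `f` is a holomorphic chart, then a fractional linear map without pole there, then an
inverse chart. Hence only the reverse inclusion matters for being relatively Hurwitz. -/
theorem moeb_le_holAut [ChartedSpace ℂ X] [IsManifold 𝓘(ℂ) ω X] {σ : AffineStructure X}
    (hσ : σ ∈ affineStructures X) : moeb (toProjective σ) ≤ holAut X := by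
  have key : ∀ f ∈ moeb (toProjective σ), MDifferentiable 𝓘(ℂ) 𝓘(ℂ) f := by
    intro f hf x
    obtain ⟨e, he, hx⟩ := σ.cover x
    obtain ⟨e', he', hx'⟩ := σ.cover (f x)
    obtain ⟨a, b, c, d, -, h⟩ := exists_moebius_of_mem_moeb hf he he' hx hx'
    have h1 : MDifferentiableAt 𝓘(ℂ) 𝓘(ℂ) e x :=
      (contMDiffAt_of_mem_maximalAtlas (hσ he) hx).mdifferentiableAt (by simp)
    have h2 : MDifferentiableAt 𝓘(ℂ) 𝓘(ℂ) e'.symm (e' (f x)) :=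
      (contMDiffAt_symm_of_mem_maximalAtlas (hσ he') (e'.map_source hx')).mdifferentiableAt
        (by simp)
    have h3 : DifferentiableAt ℂ (fun z => (a * z + b) / (c * z + d)) (e x) := by
      refine DifferentiableAt.div (by fun_prop) (by fun_prop) h.self_of_nhds.1
    rw [h.self_of_nhds.2] at h2
    have h4 := h2.comp x (h3.mdifferentiableAt.comp x h1)
    refine h4.congr_of_eventuallyEq ?_
    filter_upwards [h, f.continuous.continuousAt.eventually (e'.open_source.mem_nhds hx')]
      with y hy hy'
    simp only [Function.comp_apply]
    rw [← hy.2, e'.left_inv hy']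
  exact fun f hf => ⟨key f hf, key _ (inv_mem hf)⟩

end Moebius

/-! ### Elliptic points and units of the lattice -/

open Modular in
/-- Up to the modular group, the elliptic points are `exp (2πi/3)` and `exp (iπ/2)`. -/
theorem exists_smul_eq_iff_exists_stabilizer (τ : UpperHalfPlane) :
    (∃ γ : Matrix.SpecialLinearGroup (Fin 2) ℤ,
        ((γ • τ : UpperHalfPlane) : ℂ) = Complex.exp (2 * Real.pi * Complex.I / 3) ∨
        ((γ • τ : UpperHalfPlane) : ℂ) = Complex.exp (Complex.I * Real.pi / 2)) ↔
      ∃ g : Matrix.SpecialLinearGroup (Fin 2) ℤ, g ≠ 1 ∧ g ≠ -1 ∧ g • τ = τ := by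
  have hI : Complex.exp (Complex.I * Real.pi / 2) = (UpperHalfPlane.I : ℂ) := by
    rw [mul_comm, mul_div_right_comm, Complex.exp_pi_div_two_mul_I]
    rfl
  have hρ : Complex.exp (2 * Real.pi * Complex.I / 3) = (UpperHalfPlane.ρ : ℂ) := by
    have h1 : (2 * Real.pi * Complex.I / 3 : ℂ) = ((Real.pi - Real.pi / 3 : ℝ) : ℂ) * Complex.I := by
      push_cast; ring
    rw [h1, Complex.exp_mul_I, ← Complex.ofReal_cos, ← Complex.ofReal_sin, Real.cos_pi_sub,
      Real.sin_pi_sub, Real.cos_pi_div_three, Real.sin_pi_div_three]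
    norm_num [UpperHalfPlane.ρ, Complex.ext_iff]
  simp only [hI, hρ, ← UpperHalfPlane.ext_iff]
  have conj : ∀ γ g : Matrix.SpecialLinearGroup (Fin 2) ℤ, g ≠ 1 → g ≠ -1 →
      γ⁻¹ * g * γ ≠ 1 ∧ γ⁻¹ * g * γ ≠ -1 := by
    intro γ g h1 h2
    refine ⟨fun h => h1 ?_, fun h => h2 ?_⟩
    · have : g = γ * (γ⁻¹ * g * γ) * γ⁻¹ := by group
      rw [this, h]; simp
    · have : g = γ * (γ⁻¹ * g * γ) * γ⁻¹ := by group
      rw [this, h]; simp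
  constructor
  · have of_fixed : ∀ γ g : Matrix.SpecialLinearGroup (Fin 2) ℤ, g ≠ 1 → g ≠ -1 →
        g • γ • τ = γ • τ → ∃ g : Matrix.SpecialLinearGroup (Fin 2) ℤ,
          g ≠ 1 ∧ g ≠ -1 ∧ g • τ = τ := fun γ g h1 h2 h =>
      ⟨γ⁻¹ * g * γ, (conj γ g h1 h2).1, (conj γ g h1 h2).2, by
        rw [mul_smul, mul_smul, h, inv_smul_smul]⟩
    rintro ⟨γ, h | h⟩
    · refine of_fixed γ (ModularGroup.S * ModularGroup.T) (by decide) (by decide) ?_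
      rw [h, ModularGroup.stabilizer_ρ]
      simp
    · refine of_fixed γ ModularGroup.S (by decide) (by decide) ?_
      rw [h, ModularGroup.stabilizer_I]
      simp
  · rintro ⟨g, h1, h2, h⟩
    obtain ⟨γ, hγ⟩ := ModularGroup.exists_smul_mem_fd τ
    have h3 : (γ * g * γ⁻¹) • γ • τ = γ • τ := by
      rw [mul_smul, inv_smul_smul, mul_smul, h]
    have h4 := conj γ⁻¹ g h1 h2
    rw [inv_inv] at h4
    by_contra hne
    simp only [not_exists, not_or] at hne
    -- The closed fundamental domain has a third exceptional point, the translate of `ρ` by `1`;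
    -- `T⁻¹` brings it back to `ρ`.
    refine (ModularGroup.stabilizer_of_ne hγ h3 (hne γ).2 (hne γ).1 fun h5 => ?_).elim h4.1 h4.2
    refine (hne (ModularGroup.T⁻¹ * γ)).1 ?_
    rw [mul_smul, h5, inv_smul_eq_iff, UpperHalfPlane.modular_T_smul]

theorem mem_lattice_iff {τ : UpperHalfPlane} {z : ℂ} :
    z ∈ lattice τ ↔ ∃ m n : ℤ, (m : ℂ) + n * τ = z := by
  simp [lattice, AddSubgroup.mem_closure_pair]

theorem mul_coe_eq_iff_smul_eq {τ : UpperHalfPlane}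
    (g : Matrix.SpecialLinearGroup (Fin 2) ℤ) :
    g • τ = τ ↔ ((g 1 0 : ℂ) * τ + g 1 1) * τ = g 0 0 * τ + g 0 1 := by
  have h0 : (g 1 0 : ℂ) * τ + g 1 1 ≠ 0 := by
    have := UpperHalfPlane.denom_ne_zero (g : GL (Fin 2) ℝ) τ
    simpa [UpperHalfPlane.denom] using this
  rw [UpperHalfPlane.ext_iff, UpperHalfPlane.specialLinearGroup_apply]
  simp only [algebraMap_int_eq, eq_intCast, Complex.ofReal_intCast]
  rw [div_eq_iff h0, eq_comm, mul_comm]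

/-- Multiplication by `a` scales areas by `|a|²`, which is therefore the determinant of its integer
matrix in the basis `1, τ`. -/
theorem exists_int_mul_eq {τ : UpperHalfPlane} {a : ℂ}
    (h : ∀ l ∈ lattice τ, a * l ∈ lattice τ) :
    ∃ m n p q : ℤ, a = m + n * τ ∧ a * τ = p + q * τ ∧
      (m * q - n * p : ℝ) = Complex.normSq a := by
  obtain ⟨m, n, h1⟩ := mem_lattice_iff.1 (h 1 (mem_lattice_iff.2 ⟨1, 0, by simp⟩))
  obtain ⟨p, q, h2⟩ := mem_lattice_iff.1 (h τ (mem_lattice_iff.2 ⟨0, 1, by simp⟩))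
  rw [mul_one] at h1
  refine ⟨m, n, p, q, h1.symm, h2.symm, ?_⟩
  have hy : (τ : ℂ).im ≠ 0 := τ.im_ne_zero
  have e1 := congrArg Complex.re h1
  have e2 := congrArg Complex.im h1
  have e3 := congrArg Complex.re h2
  have e4 := congrArg Complex.im h2
  simp at e1 e2 e3 e4
  rw [Complex.normSq_apply]
  have hy' : τ.im ≠ 0 := hy
  apply mul_right_cancel₀ hy'
  rw [← e1, ← e2] at *
  linear_combination (m + n * τ.re) * e4 - n * τ.im * e3

/-- `τ` is an elliptic point if and only if its lattice has a unit other than `±1`. -/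
theorem exists_stabilizer_iff_exists_unit (τ : UpperHalfPlane) :
    (∃ g : Matrix.SpecialLinearGroup (Fin 2) ℤ, g ≠ 1 ∧ g ≠ -1 ∧ g • τ = τ) ↔
      ∃ a : ℂ, a ≠ 0 ∧ a ≠ 1 ∧ a ≠ -1 ∧ (∀ l ∈ lattice τ, a * l ∈ lattice τ) ∧
        ∀ l ∈ lattice τ, a⁻¹ * l ∈ lattice τ := by
  have hy : τ.im ≠ 0 := τ.im_ne_zero
  constructor
  · rintro ⟨g, h1, h2, h⟩
    rw [mul_coe_eq_iff_smul_eq] at h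
    have hdet : (g 0 0 : ℂ) * g 1 1 - g 0 1 * g 1 0 = 1 := by
      have := g.det_coe
      rw [Matrix.det_fin_two] at this
      exact_mod_cast this
    have h0 : (g 1 0 : ℂ) * τ + g 1 1 ≠ 0 := by
      have := UpperHalfPlane.denom_ne_zero (g : GL (Fin 2) ℝ) τ
      simpa [UpperHalfPlane.denom] using this
    have ne : ∀ ε : ℤ, ε * ε = 1 → (g 1 0 : ℂ) * τ + g 1 1 = ε →
        g 0 0 = ε ∧ g 0 1 = 0 ∧ g 1 0 = 0 ∧ g 1 1 = ε := by
      intro ε hε he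
      have hc : g 1 0 = 0 := by
        have := congrArg Complex.im he
        simpa [hy] using this
      have hd : g 1 1 = ε := by
        rw [hc] at he
        simpa using he
      rw [he] at h
      have ha : g 0 0 = ε := by
        have := congrArg Complex.im h
        simp [hy] at this
        exact_mod_cast this.symm
      rw [ha] at h
      have hb : g 0 1 = 0 := by simpa using h
      exact ⟨ha, hb, hc, hd⟩
    -- The unit is the automorphy factor `c τ + d`: since `g` fixes `τ`, it sends `1` to `c τ + d`
    -- and `τ` to `a τ + b`.
    refine ⟨(g 1 0 : ℂ) * τ + g 1 1, h0, fun he => h1 ?_, fun he => h2 ?_, ?_, ?_⟩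
    · obtain ⟨e1, e2, e3, e4⟩ := ne 1 (by norm_num) (by simpa using he)
      ext i j
      fin_cases i <;> fin_cases j <;> simp [e1, e2, e3, e4]
    · obtain ⟨e1, e2, e3, e4⟩ := ne (-1) (by norm_num) (by simpa using he)
      ext i j
      fin_cases i <;> fin_cases j <;> simp [e1, e2, e3, e4]
    · intro l hl
      obtain ⟨m, n, rfl⟩ := mem_lattice_iff.1 hl
      refine mem_lattice_iff.2 ⟨m * g 1 1 + n * g 0 1, m * g 1 0 + n * g 0 0, ?_⟩
      push_cast
      linear_combination -n * h
    · intro l hl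
      obtain ⟨m, n, rfl⟩ := mem_lattice_iff.1 hl
      -- These coordinates come from the adjugate, which is the inverse matrix because the
      -- determinant is `1`.
      refine mem_lattice_iff.2 ⟨m * g 0 0 - n * g 0 1, n * g 1 1 - m * g 1 0, ?_⟩
      rw [eq_inv_mul_iff_mul_eq₀ h0]
      push_cast
      linear_combination (n * g 1 1 - m * g 1 0) * h + (m + n * τ) * hdet
  · rintro ⟨a, h0, h1, h2, h, h'⟩
    obtain ⟨m, n, p, q, e1, e2, e3⟩ := exists_int_mul_eq h
    obtain ⟨m', n', p', q', -, -, e3'⟩ := exists_int_mul_eq h'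
    -- The determinants of `a` and `a⁻¹` are integers equal to `|a|²` and `|a|⁻²`; nonnegativity
    -- excludes `-1`.
    have hdet : (m * q - n * p) * (m' * q' - n' * p') = 1 := by
      have : ((m * q - n * p) * (m' * q' - n' * p') : ℝ) = 1 := by
        rw [e3, e3', ← Complex.normSq_mul, mul_inv_cancel₀ h0, Complex.normSq_one]
      exact_mod_cast this
    have hpos : 0 ≤ m * q - n * p := by
      have : (0 : ℝ) ≤ m * q - n * p := by rw [e3]; exact Complex.normSq_nonneg a
      exact_mod_cast this
    have hone : m * q - n * p = 1 := Int.eq_one_of_mul_eq_one_right hpos hdet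
    let g : Matrix.SpecialLinearGroup (Fin 2) ℤ :=
      ⟨!![q, p; n, m], by rw [Matrix.det_fin_two_of]; linear_combination hone⟩
    refine ⟨g, fun hg => h1 ?_, fun hg => h2 ?_, ?_⟩
    · have hn : n = 0 := congrArg (fun k : Matrix.SpecialLinearGroup (Fin 2) ℤ => k 1 0) hg
      have hm : m = 1 := congrArg (fun k : Matrix.SpecialLinearGroup (Fin 2) ℤ => k 1 1) hg
      simp [e1, hn, hm]
    · have hn : n = 0 := congrArg (fun k : Matrix.SpecialLinearGroup (Fin 2) ℤ => k 1 0) hg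
      have hm : m = -1 := congrArg (fun k : Matrix.SpecialLinearGroup (Fin 2) ℤ => k 1 1) hg
      simp [e1, hn, hm]
    · rw [mul_coe_eq_iff_smul_eq]
      simp only [g, Matrix.of_apply, Matrix.cons_val', Matrix.cons_val_zero,
        Matrix.cons_val_one, Matrix.cons_val_fin_one]
      linear_combination e2 - τ * e1

/-! ### Holomorphic charts and self-maps of the torus -/

section Torus

variable {τ : UpperHalfPlane}

theorem isCoveringMap_proj (τ : UpperHalfPlane) : IsCoveringMap (proj τ) :=
  (AddSubgroup.isAddQuotientCoveringMap_of_comm (lattice τ)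
    ⟨inferInstanceAs (DiscreteTopology (lattice τ))⟩).isCoveringMap

theorem continuous_proj (τ : UpperHalfPlane) : Continuous (proj τ) :=
  (isLocalHomeomorph_proj τ).continuous

theorem proj_eq_proj_iff {z w : ℂ} : proj τ z = proj τ w ↔ w - z ∈ lattice τ := by
  rw [QuotientAddGroup.eq, sub_eq_neg_add]

theorem proj_surjective (x : Torus τ) : ∃ z, proj τ z = x := QuotientAddGroup.mk_surjective x

theorem eventually_nhds_proj {z : ℂ} {p : Torus τ → Prop} :
    (∀ᶠ y in 𝓝 (proj τ z), p y) ↔ ∀ᶠ w in 𝓝 z, p (proj τ w) := by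
  rw [← (isLocalHomeomorph_proj τ).map_nhds_eq z, eventually_map]

theorem exists_mem_euclideanAtlas (τ : UpperHalfPlane) (z : ℂ) :
    ∃ e ∈ euclideanAtlas τ, proj τ z ∈ e.source ∧ ∀ᶠ w in 𝓝 z, e (proj τ w) = w := by
  obtain ⟨e, hz, he⟩ := isLocalHomeomorph_proj τ z
  refine ⟨e.symm, he.symm, ?_, ?_⟩
  · have := e.map_source hz
    rwa [← he] at this
  · filter_upwards [e.open_source.mem_nhds hz] with w hw
    rw [he]
    exact e.left_inv hw

theorem euclideanAtlas_subset_maximalAtlas (τ : UpperHalfPlane) :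
    euclideanAtlas τ ⊆ IsManifold.maximalAtlas 𝓘(ℂ) ω (Torus τ) :=
  IsManifold.subset_maximalAtlas (I := 𝓘(ℂ)) (n := ω) (M := Torus τ)

theorem mdifferentiable_proj (τ : UpperHalfPlane) : MDifferentiable 𝓘(ℂ) 𝓘(ℂ) (proj τ) := by
  intro z
  obtain ⟨e, he, hz, h⟩ := exists_mem_euclideanAtlas τ z
  have h1 := (contMDiffAt_symm_of_mem_maximalAtlas (euclideanAtlas_subset_maximalAtlas τ he)
    (e.map_source hz)).mdifferentiableAt (by simp)
  rwa [h.self_of_nhds, he] at h1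

theorem analyticAt_comp_proj {e : OpenPartialHomeomorph (Torus τ) ℂ}
    (he : e ∈ IsManifold.maximalAtlas 𝓘(ℂ) ω (Torus τ)) {z : ℂ} (hz : proj τ z ∈ e.source) :
    AnalyticAt ℂ (fun w => e (proj τ w)) z := by
  rw [Complex.analyticAt_iff_eventually_differentiableAt]
  filter_upwards [(continuous_proj τ).continuousAt.eventually (e.open_source.mem_nhds hz)]
    with w hw
  rw [← mdifferentiableAt_iff_differentiableAt]
  exact ((contMDiffAt_of_mem_maximalAtlas he hw).mdifferentiableAt (by simp)).comp w
    (mdifferentiable_proj τ w)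

/-- Composing with the holomorphic map from `e` to a Euclidean chart gives the identity near `z`, so
the chain rule forbids a zero derivative. -/
theorem deriv_comp_proj_ne_zero {e : OpenPartialHomeomorph (Torus τ) ℂ}
    (he : e ∈ IsManifold.maximalAtlas 𝓘(ℂ) ω (Torus τ)) {z : ℂ} (hz : proj τ z ∈ e.source) :
    deriv (fun w => e (proj τ w)) z ≠ 0 := by
  intro h0
  obtain ⟨c, hc, hzc, h⟩ := exists_mem_euclideanAtlas τ z
  have h1 := (contMDiffAt_symm_of_mem_maximalAtlas he (e.map_source hz)).mdifferentiableAt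
    (by simp)
  have h2 := (contMDiffAt_of_mem_maximalAtlas (euclideanAtlas_subset_maximalAtlas τ hc)
    hzc).mdifferentiableAt (by simp)
  rw [← e.left_inv hz] at h2
  have h3 := (h2.comp _ h1).differentiableAt.hasDerivAt.comp z
    (analyticAt_comp_proj he hz).differentiableAt.hasDerivAt
  rw [h0, mul_zero] at h3
  have h4 : HasDerivAt (fun w : ℂ => w) 0 z := by
    refine h3.congr_of_eventuallyEq ?_
    filter_upwards [h, (continuous_proj τ).continuousAt.eventually (e.open_source.mem_nhds hz)]
      with w hw hw'
    simp only [Function.comp_apply]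
    rw [e.left_inv hw', hw]
  exact zero_ne_one (h4.unique (hasDerivAt_id z))

/-- The nonvanishing derivative serves the inverse direction, through the inverse function theorem.
This is how charts of a developed structure are shown to be holomorphic. -/
theorem mem_maximalAtlas_of_analyticAt {e : OpenPartialHomeomorph (Torus τ) ℂ}
    (h : ∀ z, proj τ z ∈ e.source → AnalyticAt ℂ (fun w => e (proj τ w)) z ∧
      deriv (fun w => e (proj τ w)) z ≠ 0) :
    e ∈ IsManifold.maximalAtlas 𝓘(ℂ) ω (Torus τ) := by
  rw [IsManifold.mem_maximalAtlas_iff_contMDiffOn]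
  constructor
  · intro x hx
    obtain ⟨z, rfl⟩ := proj_surjective x
    obtain ⟨c, hc, hzc, hcz⟩ := exists_mem_euclideanAtlas τ z
    have h1 := (h z hx).1.contDiffAt (n := ω)
    rw [← hcz.self_of_nhds] at h1
    have h2 := h1.contMDiffAt.comp _
      (contMDiffAt_of_mem_maximalAtlas (euclideanAtlas_subset_maximalAtlas τ hc) hzc)
    refine (h2.congr_of_eventuallyEq ?_).contMDiffWithinAt
    rw [EventuallyEq, eventually_nhds_proj]
    filter_upwards [hcz] with w hw
    simp only [Function.comp_apply, hw]
  · intro w hw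
    obtain ⟨z, hz⟩ := proj_surjective (e.symm w)
    obtain ⟨c, hc, hzc, hcz⟩ := exists_mem_euclideanAtlas τ z
    have hcs : ⇑c.symm = proj τ := hc
    have hze : proj τ z ∈ e.source := hz ▸ e.map_target hw
    have hwt : w ∈ (c.symm ≫ₕ e).target := by
      rw [OpenPartialHomeomorph.trans_target]
      exact ⟨hw, by simpa [← hz] using hzc⟩
    have hwz : (c.symm ≫ₕ e).symm w = z := by
      simp [OpenPartialHomeomorph.trans_symm_eq_symm_trans_symm, ← hz, hcz.self_of_nhds]
    have h3 : ⇑(c.symm ≫ₕ e) = fun w => e (proj τ w) := by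
      ext w
      rw [OpenPartialHomeomorph.coe_trans, hcs]
      rfl
    obtain ⟨h1, h2⟩ := h z hze
    have h4 : ContDiffAt ℂ ω (c.symm ≫ₕ e).symm w := by
      refine OpenPartialHomeomorph.contDiffAt_symm_deriv _ h2 hwt ?_ ?_
      · rw [h3, hwz]
        exact h1.differentiableAt.hasDerivAt
      · rw [h3, hwz]
        exact h1.contDiffAt
    have h5 := contMDiffAt_symm_of_mem_maximalAtlas (euclideanAtlas_subset_maximalAtlas τ hc)
      (c.map_source hzc)
    rw [hcz.self_of_nhds, ← hwz] at h5
    have h6 := h5.comp w h4.contMDiffAt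
    refine (h6.congr_of_eventuallyEq ?_).contMDiffWithinAt
    filter_upwards [(c.symm ≫ₕ e).open_target.mem_nhds hwt] with u hu
    rw [OpenPartialHomeomorph.trans_target] at hu
    exact (c.left_inv hu.2).symm

/-- A continuous self-map of a complex torus lifts to the universal cover. -/
theorem exists_lift (f : C(Torus τ, Torus τ)) :
    ∃ F : C(ℂ, ℂ), ∀ z, f (proj τ z) = proj τ (F z) := by
  obtain ⟨z, hz⟩ := proj_surjective (f (proj τ 0))
  obtain ⟨F, ⟨-, hF⟩, -⟩ := (isCoveringMap_proj τ).existsUnique_continuousMap_lifts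
    (f.comp ⟨proj τ, continuous_proj τ⟩) 0 z hz
  exact ⟨F, fun z => (congrFun hF z).symm⟩

/-- A function invariant under the lattice and continuous is bounded. -/
theorem isBounded_range_of_periodic {E : Type*} [PseudoMetricSpace E] {h : ℂ → E}
    (hc : Continuous h) (hp : ∀ l ∈ lattice τ, ∀ z, h (z + l) = h z) :
    Bornology.IsBounded (range h) := by
  -- A compact fundamental parallelogram; fractional parts of the real coordinates in the basis `1,
  -- τ` move any point into it.
  let K : Set ℂ := (fun p : ℝ × ℝ => (p.1 : ℂ) + p.2 * τ) '' (Icc 0 1 ×ˢ Icc 0 1)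
  have hK : IsCompact K := (isCompact_Icc.prod isCompact_Icc).image (by fun_prop)
  refine (hK.image hc).isBounded.subset ?_
  rintro _ ⟨z, rfl⟩
  have hy : τ.im ≠ 0 := τ.im_ne_zero
  let t : ℝ := z.im / τ.im
  let s : ℝ := z.re - t * τ.re
  have hz : (s : ℂ) + t * τ = z := by
    apply Complex.ext
    · simp [s]
    · simp [t, hy]
  refine ⟨Int.fract s + Int.fract t * τ, ⟨(Int.fract s, Int.fract t),
    ⟨⟨Int.fract_nonneg _, (Int.fract_lt_one _).le⟩,
      ⟨Int.fract_nonneg _, (Int.fract_lt_one _).le⟩⟩, rfl⟩, ?_⟩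
  rw [← hp (⌊s⌋ + ⌊t⌋ * τ) (mem_lattice_iff.2 ⟨_, _, rfl⟩)]
  congr 1
  rw [← hz]
  conv_rhs => rw [← Int.floor_add_fract s, ← Int.floor_add_fract t]
  push_cast
  ring

/-- A continuous map from a connected space to a discrete one is constant. -/
theorem eq_of_sub_mem_lattice {F : ℂ → ℂ} (hF : Continuous F)
    (h : ∀ z, F z ∈ lattice τ) (z w : ℂ) : F z = F w := by
  have : Continuous fun z => (⟨F z, h z⟩ : lattice τ) := hF.subtype_mk h
  exact congrArg Subtype.val (PreconnectedSpace.constant inferInstance this (x := z) (y := w))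

/-- A holomorphic self-map of a complex torus is affine on the universal cover. -/
theorem exists_affine_lift {f : Torus τ → Torus τ} (hf : MDifferentiable 𝓘(ℂ) 𝓘(ℂ) f) :
    ∃ a b : ℂ, ∀ z, f (proj τ z) = proj τ (a * z + b) := by
  obtain ⟨F, hF⟩ := exists_lift ⟨f, hf.continuous⟩
  simp only [ContinuousMap.coe_mk] at hF
  have hd : Differentiable ℂ F := by
    intro z
    obtain ⟨e, he, hz, h⟩ := exists_mem_euclideanAtlas τ (F z)
    rw [← mdifferentiableAt_iff_differentiableAt]
    rw [← hF] at hz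
    have h1 := (contMDiffAt_of_mem_maximalAtlas (euclideanAtlas_subset_maximalAtlas τ he)
      hz).mdifferentiableAt (by simp)
    refine (h1.comp z ((hf _).comp z (mdifferentiable_proj τ z))).congr_of_eventuallyEq ?_
    filter_upwards [F.continuous.continuousAt.eventually h] with w hw
    rw [← hF] at hw
    exact hw.symm
  -- The lift is periodic only up to a lattice-valued, hence constant, increment; its derivative is
  -- truly periodic, and Liouville applies to that.
  have hper : ∀ l ∈ lattice τ, ∀ z, deriv F (z + l) = deriv F z := by
    intro l hl z
    have hmem : ∀ z, F (z + l) - F z ∈ lattice τ := fun z => by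
      rw [← proj_eq_proj_iff, ← hF, ← hF, proj_eq_proj_iff.2 (show z + l - z ∈ lattice τ by simpa)]
    have hconst := eq_of_sub_mem_lattice (F := fun z => F (z + l) - F z) (by fun_prop) hmem
    have : (fun w => F (w + l)) = fun w => F w + (F (0 + l) - F 0) := by
      ext w
      linear_combination hconst w 0
    rw [← deriv_comp_add_const, this, deriv_add_const]
  have hdd : Differentiable ℂ (deriv F) := hd.contDiff.differentiable_deriv_two
  have hbound := isBounded_range_of_periodic hdd.continuous hper
  have hconst := hdd.apply_eq_apply_of_bounded hbound
  refine ⟨deriv F 0, F 0, fun z => ?_⟩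
  rw [hF]
  congr 1
  have := is_const_of_deriv_eq_zero (f := fun z => F z - deriv F 0 * z) (by fun_prop)
    (fun w => by
      rw [deriv_fun_sub hd.differentiableAt (by fun_prop), deriv_const_mul_field, deriv_id'',
        hconst w 0]
      simp) z 0
  simp only [mul_zero, sub_zero] at this
  linear_combination this

theorem mdifferentiable_of_lift {f : Torus τ → Torus τ} {F : ℂ → ℂ} (hF : Differentiable ℂ F)
    (h : ∀ z, f (proj τ z) = proj τ (F z)) : MDifferentiable 𝓘(ℂ) 𝓘(ℂ) f := by
  intro x
  obtain ⟨z, rfl⟩ := proj_surjective x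
  obtain ⟨e, he, hz, hez⟩ := exists_mem_euclideanAtlas τ z
  have h1 := (contMDiffAt_of_mem_maximalAtlas (euclideanAtlas_subset_maximalAtlas τ he)
    hz).mdifferentiableAt (by simp)
  have h2 := ((mdifferentiable_proj τ _).comp _ (hF _).mdifferentiableAt).comp _ h1
  refine h2.congr_of_eventuallyEq ?_
  rw [EventuallyEq, eventually_nhds_proj]
  filter_upwards [hez] with w hw
  simp only [Function.comp_apply, hw, h]

end Torus

/-! ### Affine structures given by a developing map -/

section Developed

variable {τ : UpperHalfPlane}

/-- The chart is `D` after a local inverse of the projection. At another preimage that inverse is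
off by a period, whose effect on `D` is affine by `heq`. -/
theorem exists_chart_of_isLocalHomeomorph {D : ℂ → ℂ} (hD : IsLocalHomeomorph D)
    (heq : ∀ l ∈ lattice τ, ∃ g ∈ affineGroup, ∀ z, D (z + l) = g (D z)) (z : ℂ) :
    ∃ e : OpenPartialHomeomorph (Torus τ) ℂ, proj τ z ∈ e.source ∧
      ∀ z, proj τ z ∈ e.source → ∃ g ∈ affineGroup, ∀ᶠ w in 𝓝 z, e (proj τ w) = g (D w) := by
  obtain ⟨c, hc, hz, hcz⟩ := exists_mem_euclideanAtlas τ z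
  obtain ⟨d, hd, rfl⟩ := hD z
  refine ⟨c ≫ₕ d, ?_, fun z' hz' => ?_⟩
  · rw [OpenPartialHomeomorph.trans_source]
    exact ⟨hz, by simpa [hcz.self_of_nhds] using hd⟩
  · rw [OpenPartialHomeomorph.trans_source] at hz'
    have hcs : ⇑c.symm = proj τ := hc
    have hmem : ∀ w, proj τ w ∈ c.source → c (proj τ w) - w ∈ lattice τ := fun w hw => by
      rw [← proj_eq_proj_iff]
      exact ((congrFun hcs _).symm.trans (c.left_inv hw)).symm
    obtain ⟨c', hc', hz'', hcz'⟩ := exists_mem_euclideanAtlas τ z'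
    have hsrc : z' ∈ (c'.symm ≫ₕ c).source := by
      rw [OpenPartialHomeomorph.trans_source]
      refine ⟨?_, ?_⟩
      · have := c'.map_source hz''
        rwa [hcz'.self_of_nhds] at this
      · rw [mem_preimage, show ⇑c'.symm = proj τ from hc']
        exact hz'.1
    obtain ⟨b, hb⟩ := euclideanAtlas_compatible τ c' hc' c hc z' hsrc
    simp only [OpenPartialHomeomorph.coe_trans, Function.comp_apply,
      show ⇑c'.symm = proj τ from hc'] at hb
    have hbl : b ∈ lattice τ := by
      have := hmem z' hz'.1
      rwa [hb.self_of_nhds, add_sub_cancel_left] at this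
    obtain ⟨g, hg, h⟩ := heq b hbl
    refine ⟨g, hg, ?_⟩
    filter_upwards [hb] with w hw
    rw [← h, ← hw]
    rfl

/-- The affine structure on `X_τ` with developing map `D : ℂ → ℂ`. -/
def developed (D : ℂ → ℂ) (hD : IsLocalHomeomorph D)
    (heq : ∀ l ∈ lattice τ, ∃ g ∈ affineGroup, ∀ z, D (z + l) = g (D z)) :
    AffineStructure (Torus τ) where
  charts := {e | ∀ z, proj τ z ∈ e.source →
    ∃ g ∈ affineGroup, ∀ᶠ w in 𝓝 z, e (proj τ w) = g (D w)}
  cover x := by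
    obtain ⟨z, rfl⟩ := proj_surjective x
    obtain ⟨e, hz, he⟩ := exists_chart_of_isLocalHomeomorph hD heq z
    exact ⟨e, he, hz⟩
  compatible e he e' he' := by
    rw [symm_trans_mem_localGroupoid_iff]
    intro x hx hx'
    obtain ⟨z, rfl⟩ := proj_surjective x
    obtain ⟨g, hg, h⟩ := he z hx
    obtain ⟨g', hg', h'⟩ := he' z hx'
    refine ⟨g' * g⁻¹, mul_mem hg' (inv_mem hg), ?_⟩
    rw [eventually_nhds_proj]
    filter_upwards [h, h'] with w hw hw'
    simp [hw, hw']
  maximal e he z hz := by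
    obtain ⟨c, hzc, hc⟩ := exists_chart_of_isLocalHomeomorph hD heq z
    obtain ⟨g, hg, h⟩ := symm_trans_mem_localGroupoid_iff.1 (he c hc) _ hzc hz
    obtain ⟨k, hk, h'⟩ := hc z hzc
    refine ⟨g * k, mul_mem hg hk, ?_⟩
    filter_upwards [eventually_nhds_proj.1 h, h'] with w hw hw'
    rw [hw, hw']
    rfl

theorem developed_mem_affineStructures {D : ℂ → ℂ} {hD : IsLocalHomeomorph D}
    {heq : ∀ l ∈ lattice τ, ∃ g ∈ affineGroup, ∀ z, D (z + l) = g (D z)}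
    (hd : Differentiable ℂ D) (hd' : ∀ z, deriv D z ≠ 0) :
    developed D hD heq ∈ affineStructures (Torus τ) := by
  intro e he
  refine mem_maximalAtlas_of_analyticAt fun z hz => ?_
  obtain ⟨g, ⟨a, b, ha, hg⟩, h⟩ := he z hz
  have h1 : (fun w => e (proj τ w)) =ᶠ[𝓝 z] fun w => a * D w + b :=
    h.mono fun w hw => hw.trans (hg _)
  refine ⟨?_, ?_⟩
  · exact ((analyticAt_const.mul (hd.analyticAt z)).add analyticAt_const).congr h1.symm
  · rw [h1.deriv_eq, deriv_add_const, deriv_const_mul_field]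
    exact mul_ne_zero ha (hd' z)

/-- An affine map of the universal cover acts projectively if it does so through the developing
map. -/
theorem mem_moeb_developed {D : ℂ → ℂ} {hD : IsLocalHomeomorph D}
    {heq : ∀ l ∈ lattice τ, ∃ g ∈ affineGroup, ∀ z, D (z + l) = g (D z)}
    {f : Torus τ ≃ₜ Torus τ} {F : ℂ → ℂ} (hF : Continuous F)
    (hf : ∀ z, f (proj τ z) = proj τ (F z))
    {m : Equiv.Perm Sphere} (hm : m ∈ moebiusGroup) (h : ∀ z, m (D z) = (D (F z) : ℂ)) :
    f ∈ moeb (toProjective (developed D hD heq)) := by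
  refine mem_moeb_of_exists fun x => ?_
  obtain ⟨z, rfl⟩ := proj_surjective x
  obtain ⟨e, hz, he⟩ := exists_chart_of_isLocalHomeomorph hD heq z
  obtain ⟨e', hz', he'⟩ := exists_chart_of_isLocalHomeomorph hD heq (F z)
  obtain ⟨g, hg, hge⟩ := he z hz
  obtain ⟨g', hg', hge'⟩ := he' (F z) hz'
  obtain ⟨k, hk, hkg⟩ := exists_moebius_of_affine (inv_mem hg)
  obtain ⟨k', hk', hkg'⟩ := exists_moebius_of_affine hg'
  refine ⟨e, he, e', he', hz, by rwa [hf], k' * m * k, mul_mem (mul_mem hk' hm) hk, ?_⟩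
  rw [eventually_nhds_proj]
  filter_upwards [hge, hF.continuousAt.eventually hge'] with w hw hw'
  rw [hf, hw', hw, Equiv.Perm.mul_apply, Equiv.Perm.mul_apply, hkg,
    show g⁻¹ (g (D w)) = D w from g.symm_apply_apply _, h, hkg']

theorem euclideanUniformization_eq (τ : UpperHalfPlane) :
    euclideanUniformization τ = developed id (Homeomorph.refl ℂ).isLocalHomeomorph
      (fun l _ => ⟨Equiv.addRight l, ⟨1, l, one_ne_zero, by simp⟩, by simp⟩) := by
  refine GStructure.eq_of_charts_subset fun e he z hz => ?_
  obtain ⟨c, hc, hzc, h⟩ := exists_mem_euclideanAtlas τ z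
  obtain ⟨g, hg, h'⟩ := symm_trans_mem_localGroupoid_iff.1 (he c hc) _ hzc hz
  refine ⟨g, hg, ?_⟩
  filter_upwards [h, eventually_nhds_proj.1 h'] with w hw hw'
  rw [hw', hw]
  rfl

theorem euclideanUniformization_mem_affineStructures (τ : UpperHalfPlane) :
    euclideanUniformization τ ∈ affineStructures (Torus τ) := by
  rw [euclideanUniformization_eq]
  exact developed_mem_affineStructures differentiable_id (by simp)

theorem isLocalHomeomorph_cexp : IsLocalHomeomorph Complex.exp :=
  isOpen_ne.isOpenEmbedding_subtypeVal.isLocalHomeomorph.comp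
    Complex.isCoveringMap_exp.isLocalHomeomorph

/-- The affine structure with developing map `exp`. -/
def expStructure (τ : UpperHalfPlane) : AffineStructure (Torus τ) :=
  developed Complex.exp isLocalHomeomorph_cexp fun l _ =>
    ⟨Equiv.mulLeft₀ (Complex.exp l) (Complex.exp_ne_zero l),
      ⟨Complex.exp l, 0, Complex.exp_ne_zero l, by simp⟩, fun z => by
        simp [Complex.exp_add, mul_comm]⟩

theorem expStructure_mem_affineStructures (τ : UpperHalfPlane) :
    expStructure τ ∈ affineStructures (Torus τ) :=
  developed_mem_affineStructures Complex.differentiable_exp (by simp)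

/-- A common chart would make an affine function of `exp w` affine in `w`; second derivatives at `0`
disagree. -/
theorem expStructure_ne (τ : UpperHalfPlane) : expStructure τ ≠ euclideanUniformization τ := by
  intro h
  rw [euclideanUniformization_eq] at h
  obtain ⟨e, he, hz⟩ := (expStructure τ).cover (proj τ 0)
  obtain ⟨g, ⟨a, b, ha, hg⟩, h1⟩ := he 0 hz
  rw [h] at he
  obtain ⟨g', ⟨a', b', -, hg'⟩, h2⟩ := he 0 hz
  have h3 : (fun w => a * Complex.exp w + b) =ᶠ[𝓝 0] fun w => a' * w + b' := by
    filter_upwards [h1, h2] with w hw hw'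
    rw [← hg, ← hw, hw', hg']
    rfl
  have h4 := h3.deriv.deriv_eq
  simp at h4
  exact ha h4

end Developed

/-! ### Automorphisms of the torus and the two model structures -/

section Units

variable {τ : UpperHalfPlane}

/-- The linear part of a lift of an automorphism of `X_τ` is a unit of the lattice. -/
theorem mul_mem_lattice_of_lift {f : Torus τ ≃ₜ Torus τ} {a b : ℂ}
    (h : ∀ z, f (proj τ z) = proj τ (a * z + b)) :
    a ≠ 0 ∧ (∀ l ∈ lattice τ, a * l ∈ lattice τ) ∧ ∀ l ∈ lattice τ, a⁻¹ * l ∈ lattice τ := by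
  have key : ∀ z, z ∈ lattice τ ↔ a * z ∈ lattice τ := by
    intro z
    have h1 : proj τ 0 = proj τ z ↔ z ∈ lattice τ := by rw [proj_eq_proj_iff, sub_zero]
    rw [← h1, ← f.injective.eq_iff, h, h, proj_eq_proj_iff]
    simp
  have ha : a ≠ 0 := by
    rintro rfl
    -- If `a = 0`, every complex number would be a period, but `1/2` is not.
    have h2 := (key 2⁻¹).2 (by simp [zero_mem])
    obtain ⟨m, n, hmn⟩ := mem_lattice_iff.1 h2
    have him := congrArg Complex.im hmn
    have hn : n = 0 := by simpa [τ.im_ne_zero] using him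
    subst hn
    have hre : (m : ℂ) * 2 = 1 := by
      rw [Int.cast_zero, zero_mul, add_zero] at hmn
      rw [hmn]; norm_num
    have : m * 2 = 1 := by exact_mod_cast hre
    omega
  exact ⟨ha, fun l hl => (key l).1 hl, fun l hl => (key _).2 (by rwa [mul_inv_cancel_left₀ ha])⟩

theorem exists_lift_of_mem_holAut {f : Torus τ ≃ₜ Torus τ} (hf : f ∈ holAut (Torus τ)) :
    ∃ a b : ℂ, ∀ z, f (proj τ z) = proj τ (a * z + b) :=
  exists_affine_lift hf.1

/-- Complex multiplication by a unit of the lattice. -/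
theorem exists_mem_holAut_of_unit {a : ℂ} (ha : a ≠ 0)
    (h : ∀ l ∈ lattice τ, a * l ∈ lattice τ) (h' : ∀ l ∈ lattice τ, a⁻¹ * l ∈ lattice τ) :
    ∃ f ∈ holAut (Torus τ), ∀ z, f (proj τ z) = proj τ (a * z) := by
  let F : Torus τ → Torus τ :=
    QuotientAddGroup.map (lattice τ) (lattice τ) (AddMonoidHom.mulLeft a) h
  let K : Torus τ → Torus τ :=
    QuotientAddGroup.map (lattice τ) (lattice τ) (AddMonoidHom.mulLeft a⁻¹) h'
  have hF : ∀ z, F (proj τ z) = proj τ (a * z) := fun z => rfl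
  have hK : ∀ z, K (proj τ z) = proj τ (a⁻¹ * z) := fun z => rfl
  have hFd : MDifferentiable 𝓘(ℂ) 𝓘(ℂ) F := mdifferentiable_of_lift (by fun_prop) hF
  have hKd : MDifferentiable 𝓘(ℂ) 𝓘(ℂ) K := mdifferentiable_of_lift (by fun_prop) hK
  let f : Torus τ ≃ₜ Torus τ :=
    { toFun := F
      invFun := K
      left_inv := fun x => by
        obtain ⟨z, rfl⟩ := proj_surjective x
        rw [hF, hK, inv_mul_cancel_left₀ ha]
      right_inv := fun x => by
        obtain ⟨z, rfl⟩ := proj_surjective x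
        rw [hK, hF, mul_inv_cancel_left₀ ha]
      continuous_toFun := hFd.continuous
      continuous_invFun := hKd.continuous }
  exact ⟨f, ⟨hFd, hKd⟩, hF⟩

theorem isRelativelyHurwitz_euclideanUniformization (τ : UpperHalfPlane) :
    IsRelativelyHurwitz (toProjective (euclideanUniformization τ)) := by
  refine (moeb_le_holAut (euclideanUniformization_mem_affineStructures τ)).antisymm fun f hf => ?_
  obtain ⟨a, b, h⟩ := exists_lift_of_mem_holAut hf
  obtain ⟨m, hm, hmab⟩ := exists_moebius_of_coeff (a := a) (b := b) (c := 0) (d := 1)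
    (by simpa using (mul_mem_lattice_of_lift h).1)
  rw [euclideanUniformization_eq]
  exact mem_moeb_developed (F := fun z => a * z + b) (by fun_prop) h hm
    fun z => by simpa using hmab z (by simp)

theorem isRelativelyHurwitz_expStructure
    (h : ¬∃ a : ℂ, a ≠ 0 ∧ a ≠ 1 ∧ a ≠ -1 ∧ (∀ l ∈ lattice τ, a * l ∈ lattice τ) ∧
      ∀ l ∈ lattice τ, a⁻¹ * l ∈ lattice τ) :
    IsRelativelyHurwitz (toProjective (expStructure τ)) := by
  refine (moeb_le_holAut (expStructure_mem_affineStructures τ)).antisymm fun f hf => ?_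
  obtain ⟨a, b, hab⟩ := exists_lift_of_mem_holAut hf
  obtain ⟨ha, h1, h2⟩ := mul_mem_lattice_of_lift hab
  have ha' : a = 1 ∨ a = -1 := by
    by_contra hne
    rw [not_or] at hne
    exact h ⟨a, ha, hne.1, hne.2, h1, h2⟩
  obtain rfl | rfl := ha'
  · obtain ⟨m, hm, hmab⟩ := exists_moebius_of_coeff (a := Complex.exp b) (b := 0) (c := 0) (d := 1)
      (by simp)
    exact mem_moeb_developed (F := fun z => 1 * z + b) (by fun_prop) hab hm fun z => by
      rw [hmab _ (by simp)]
      simp [Complex.exp_add, mul_comm]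
  -- `exp (-z + b) = exp b / exp z`: the lift acts through an inversion, which is Möbius but not
  -- affine.
  · obtain ⟨m, hm, hmab⟩ := exists_moebius_of_coeff (a := 0) (b := Complex.exp b) (c := 1) (d := 0)
      (by simp)
    exact mem_moeb_developed (F := fun z => -1 * z + b) (by fun_prop) hab hm fun z => by
      rw [hmab _ (by simp)]
      simp [Complex.exp_add, Complex.exp_neg, div_eq_inv_mul]

end Units

/-! ### Germs with constant `φ''/φ'`, and independence of exponentials -/

section Analysis

theorem logDeriv_deriv_congr_affine {u v : ℂ → ℂ} {a b z : ℂ} (ha : a ≠ 0)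
    (h : ∀ᶠ w in 𝓝 z, u w = a * v w + b) : logDeriv (deriv u) z = logDeriv (deriv v) z := by
  have h1 : deriv (fun w => a * v w + b) = fun w => a * deriv v w := by
    ext w
    rw [deriv_add_const, deriv_const_mul_field]
  have h2 : deriv u =ᶠ[𝓝 z] fun w => a * deriv v w := by
    have := EventuallyEq.deriv (f := fun w => a * v w + b) h
    rwa [h1] at this
  rw [logDeriv_apply, logDeriv_apply, h2.deriv_eq, h2.self_of_nhds, deriv_const_mul_field,
    mul_div_mul_left _ _ ha]

theorem eventually_eq_of_eventually_deriv_eq_zero {v : ℂ → ℂ} {z : ℂ} (hv : AnalyticAt ℂ v z)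
    (h : ∀ᶠ w in 𝓝 z, deriv v w = 0) : ∀ᶠ w in 𝓝 z, v w = v z := by
  obtain ⟨r, hr, hball⟩ := Metric.eventually_nhds_iff_ball.1 (h.and hv.eventually_analyticAt)
  filter_upwards [Metric.ball_mem_nhds z hr] with w hw
  exact Metric.isOpen_ball.is_const_of_deriv_eq_zero (convex_ball z r).isPreconnected
    (fun x hx => (hball x hx).2.differentiableAt.differentiableWithinAt)
    (fun x hx => (hball x hx).1) hw (Metric.mem_ball_self hr)

/-- The product `u' exp (-c w)` has zero derivative near `z`. -/
theorem eventually_deriv_eq_of_logDeriv_eq {u : ℂ → ℂ} {c z : ℂ} (hu : AnalyticAt ℂ u z)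
    (h0 : deriv u z ≠ 0) (h : ∀ᶠ w in 𝓝 z, logDeriv (deriv u) w = c) :
    ∃ k ≠ 0, ∀ᶠ w in 𝓝 z, deriv u w = k * Complex.exp (c * w) := by
  have hne : ∀ᶠ w in 𝓝 z, deriv u w ≠ 0 := hu.deriv.continuousAt.eventually_ne h0
  have hA : AnalyticAt ℂ (fun w => deriv u w * Complex.exp (-c * w)) z :=
    hu.deriv.mul (AnalyticAt.cexp (by fun_prop))
  refine ⟨deriv u z * Complex.exp (-c * z), mul_ne_zero h0 (Complex.exp_ne_zero _), ?_⟩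
  have := eventually_eq_of_eventually_deriv_eq_zero hA (by
    filter_upwards [h, hne, hu.eventually_analyticAt] with w hw hw0 hwu
    have hE : HasDerivAt (fun w => Complex.exp (-c * w)) (Complex.exp (-c * w) * (-c * 1)) w :=
      ((hasDerivAt_id w).const_mul (-c)).cexp
    rw [(hwu.deriv.differentiableAt.hasDerivAt.fun_mul hE).deriv]
    rw [logDeriv_apply, div_eq_iff hw0] at hw
    rw [hw]
    ring)
  filter_upwards [this] with w hw
  rw [← hw, mul_assoc, ← Complex.exp_add]
  simp

theorem eventually_eq_affine_of_logDeriv_eq_zero {u : ℂ → ℂ} {z : ℂ} (hu : AnalyticAt ℂ u z)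
    (h0 : deriv u z ≠ 0) (h : ∀ᶠ w in 𝓝 z, logDeriv (deriv u) w = 0) :
    ∃ a ≠ 0, ∃ b, ∀ᶠ w in 𝓝 z, u w = a * w + b := by
  obtain ⟨k, hk, hku⟩ := eventually_deriv_eq_of_logDeriv_eq hu h0 h
  have hA : AnalyticAt ℂ (fun w => u w - k * w) z := by fun_prop
  refine ⟨k, hk, u z - k * z, ?_⟩
  have := eventually_eq_of_eventually_deriv_eq_zero hA (by
    filter_upwards [hku, hu.eventually_analyticAt] with w hw hwu
    rw [(hwu.differentiableAt.hasDerivAt.fun_sub ((hasDerivAt_id' w).const_mul k)).deriv, hw]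
    simp)
  filter_upwards [this] with w hw
  linear_combination hw

theorem eventually_eq_exp_of_logDeriv_eq {u : ℂ → ℂ} {c z : ℂ} (hc : c ≠ 0)
    (hu : AnalyticAt ℂ u z) (h0 : deriv u z ≠ 0)
    (h : ∀ᶠ w in 𝓝 z, logDeriv (deriv u) w = c) :
    ∃ a ≠ 0, ∃ b, ∀ᶠ w in 𝓝 z, u w = a * Complex.exp (c * w) + b := by
  obtain ⟨k, hk, hku⟩ := eventually_deriv_eq_of_logDeriv_eq hu h0 h
  have hA : AnalyticAt ℂ (fun w => u w - k / c * Complex.exp (c * w)) z :=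
    hu.sub (analyticAt_const.mul (AnalyticAt.cexp (by fun_prop)))
  refine ⟨k / c, div_ne_zero hk hc, u z - k / c * Complex.exp (c * z), ?_⟩
  have := eventually_eq_of_eventually_deriv_eq_zero hA (by
    filter_upwards [hku, hu.eventually_analyticAt] with w hw hwu
    have hE : HasDerivAt (fun w => Complex.exp (c * w)) (Complex.exp (c * w) * (c * 1)) w :=
      ((hasDerivAt_id w).const_mul c).cexp
    rw [(hwu.differentiableAt.hasDerivAt.fun_sub (hE.const_mul (k / c))).deriv, hw]
    field_simp
    ring)
  filter_upwards [this] with w hw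
  linear_combination hw

/-- Exponentials with distinct exponents are linearly independent as germs. -/
theorem coeff_eq_zero_of_sum_exp_eventually_eq_zero {ι : Type*} [Fintype ι] {μ : ι → ℂ}
    (hμ : Function.Injective μ) {k : ι → ℂ}
    (h : ∀ᶠ w in 𝓝 (0 : ℂ), ∑ i, k i * Complex.exp (μ i * w) = 0) (i : ι) : k i = 0 := by
  have hglob : (fun w => ∑ i, k i * Complex.exp (μ i * w)) = fun _ => 0 := by
    refine AnalyticOnNhd.eq_of_eventuallyEq (𝕜 := ℂ) (z₀ := 0) ?_ analyticOnNhd_const h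
    exact fun z _ => (show Differentiable ℂ fun w => ∑ i, k i * Complex.exp (μ i * w) by
      fun_prop).analyticAt z
  -- Exponentials are characters of the additive group of `ℂ`, so Dedekind's independence of
  -- characters applies once the germ identity holds globally.
  let χ : ι → (Multiplicative ℂ →* ℂ) := fun i =>
    { toFun := fun w => Complex.exp (μ i * w.toAdd)
      map_one' := by simp
      map_mul' := fun x y => by simp [mul_add, Complex.exp_add] }
  have hχ : Function.Injective χ := by
    intro i j hij
    apply hμ
    have h1 : (fun w : ℂ => Complex.exp (μ i * w)) = fun w => Complex.exp (μ j * w) := by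
      ext w
      exact DFunLike.congr_fun hij (Multiplicative.ofAdd w)
    have h2 : ∀ c : ℂ, deriv (fun w : ℂ => Complex.exp (c * w)) 0 = c := fun c => by
      rw [((hasDerivAt_id' (0 : ℂ)).const_mul c).cexp.deriv]
      simp
    rw [← h2 (μ i), h1, h2]
  have hli := (linearIndependent_monoidHom (Multiplicative ℂ) ℂ).comp χ hχ
  refine Fintype.linearIndependent_iff.1 hli k ?_ i
  ext w
  have := congrFun hglob w.toAdd
  simpa [χ] using this

/-- A Möbius relation between `exp (c w)` and `exp (c a w)` forces `a = ±1`. -/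
theorem false_of_moebius_exp {a c α β A B C D : ℂ} (ha : a ≠ 0) (ha1 : a ≠ 1) (ha2 : a ≠ -1)
    (hc : c ≠ 0) (hα : α ≠ 0) (hdet : A * D - B * C ≠ 0)
    (h : ∀ᶠ w in 𝓝 (0 : ℂ), C * (α * Complex.exp (c * w) + β) + D ≠ 0 ∧
      α * Complex.exp (c * (a * w)) + β = (A * (α * Complex.exp (c * w) + β) + B) /
        (C * (α * Complex.exp (c * w) + β) + D)) : False := by
  -- These exponents appear after clearing the denominator. Excluding `a = 1` separates `c a` from
  -- `c`; excluding `a = -1` separates `c (1 + a)` from `0`.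
  have hμ : Function.Injective ![c * (1 + a), c * a, c, 0] := by
    have e1 : 1 + a ≠ 0 := fun h => ha2 (by linear_combination h)
    intro i j hij
    fin_cases i <;> fin_cases j <;> simp_all [eq_comm]
  have key := coeff_eq_zero_of_sum_exp_eventually_eq_zero hμ
    (k := ![α * α * C, α * (C * β + D), α * (C * β - A), β * (C * β + D) - (A * β + B)]) (by
      filter_upwards [h] with w hw
      have h2 := hw.2
      rw [eq_div_iff hw.1] at h2
      simp only [Fin.sum_univ_four, Matrix.cons_val]
      rw [mul_add c, mul_one, add_mul, Complex.exp_add, zero_mul, Complex.exp_zero]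
      rw [← mul_assoc] at h2
      linear_combination h2)
  -- The first two coefficients already kill the bottom row of the Möbius matrix.
  have k0 : C = 0 := by simpa [hα] using key 0
  have k1 : D = 0 := by simpa [hα, k0] using key 1
  exact hdet (by rw [k0, k1]; ring)

end Analysis

/-! ### Constancy of the nonlinearity and uniqueness of the Euclidean structure -/

section Uniqueness

variable {τ : UpperHalfPlane}

/-- The logarithmic derivative `φ'' / φ'` of the derivative of affine charts, read on the
universal cover. -/
def nonlinearity (σ : AffineStructure (Torus τ)) (z : ℂ) : ℂ :=
  logDeriv (deriv fun w => (σ.cover (proj τ z)).choose (proj τ w)) z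

/-- Independence of the chosen chart: transitions are affine, and `φ''/φ'` ignores affine
postcomposition. -/
theorem nonlinearity_eq {σ : AffineStructure (Torus τ)} {e : OpenPartialHomeomorph (Torus τ) ℂ}
    (he : e ∈ σ.charts) {z : ℂ} (hz : proj τ z ∈ e.source) :
    nonlinearity σ z = logDeriv (deriv fun w => e (proj τ w)) z := by
  obtain ⟨hc, hzc⟩ := (σ.cover (proj τ z)).choose_spec
  obtain ⟨g, ⟨a, b, ha, hg⟩, h⟩ :=
    symm_trans_mem_localGroupoid_iff.1 (σ.compatible e he _ hc) _ hz hzc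
  refine logDeriv_deriv_congr_affine (b := b) ha ?_
  filter_upwards [eventually_nhds_proj.1 h] with w hw
  rw [hw, hg]

theorem eventually_nonlinearity_eq {σ : AffineStructure (Torus τ)}
    {e : OpenPartialHomeomorph (Torus τ) ℂ}
    (he : e ∈ σ.charts) {z : ℂ} (hz : proj τ z ∈ e.source) :
    ∀ᶠ w in 𝓝 z, nonlinearity σ w = logDeriv (deriv fun w => e (proj τ w)) w := by
  filter_upwards [(continuous_proj τ).continuousAt.eventually (e.open_source.mem_nhds hz)]
    with w hw
  exact nonlinearity_eq he hw

theorem differentiable_nonlinearity {σ : AffineStructure (Torus τ)}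
    (hσ : σ ∈ affineStructures (Torus τ)) : Differentiable ℂ (nonlinearity σ) := by
  intro z
  obtain ⟨e, he, hz⟩ := σ.cover (proj τ z)
  have hA := (analyticAt_comp_proj (hσ he) hz).deriv
  exact (hA.deriv.div hA (deriv_comp_proj_ne_zero (hσ he) hz)).differentiableAt
    |>.congr_of_eventuallyEq (eventually_nonlinearity_eq he hz)

theorem nonlinearity_add (σ : AffineStructure (Torus τ)) {l : ℂ} (hl : l ∈ lattice τ) (z : ℂ) :
    nonlinearity σ (z + l) = nonlinearity σ z := by
  have hp : ∀ z, proj τ (z + l) = proj τ z := fun z => by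
    rw [eq_comm, proj_eq_proj_iff, add_sub_cancel_left]
    exact hl
  obtain ⟨e, he, hz⟩ := σ.cover (proj τ z)
  rw [nonlinearity_eq he hz, nonlinearity_eq he (by rwa [hp])]
  have h1 : ∀ w, deriv (fun w => e (proj τ w)) (w + l) = deriv (fun w => e (proj τ w)) w := by
    intro w
    rw [← deriv_comp_add_const]
    simp only [hp]
  rw [logDeriv_apply, logDeriv_apply, h1, ← deriv_comp_add_const]
  simp only [h1]

theorem exists_nonlinearity_eq_const {σ : AffineStructure (Torus τ)}
    (hσ : σ ∈ affineStructures (Torus τ)) : ∃ c, ∀ z, nonlinearity σ z = c :=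
  ⟨_, fun z => (differentiable_nonlinearity hσ).apply_eq_apply_of_bounded
    (isBounded_range_of_periodic (differentiable_nonlinearity hσ).continuous
      fun _ hl z => nonlinearity_add σ hl z) z 0⟩

theorem eq_euclideanUniformization_of_nonlinearity_eq_zero {σ : AffineStructure (Torus τ)}
    (hσ : σ ∈ affineStructures (Torus τ)) (h : ∀ z, nonlinearity σ z = 0) :
    σ = euclideanUniformization τ := by
  rw [euclideanUniformization_eq]
  refine GStructure.eq_of_charts_subset fun e he z hz => ?_
  obtain ⟨a, ha, b, hab⟩ := eventually_eq_affine_of_logDeriv_eq_zero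
    (analyticAt_comp_proj (hσ he) hz) (deriv_comp_proj_ne_zero (hσ he) hz)
    ((eventually_nonlinearity_eq he hz).mono fun w hw => hw.symm.trans (h w))
  refine ⟨(Equiv.mulLeft₀ a ha).trans (Equiv.addRight b), ⟨a, b, ha, by simp⟩, ?_⟩
  filter_upwards [hab] with w hw
  simp [hw]

/-- A complex multiplication other than `±1` is projective only for the Euclidean structure. -/
theorem eq_euclideanUniformization_of_mem_moeb {σ : AffineStructure (Torus τ)}
    (hσ : σ ∈ affineStructures (Torus τ)) {f : Torus τ ≃ₜ Torus τ}
    (hf : f ∈ moeb (toProjective σ)) {a : ℂ} (ha : a ≠ 0) (ha1 : a ≠ 1) (ha2 : a ≠ -1)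
    (hfa : ∀ z, f (proj τ z) = proj τ (a * z)) : σ = euclideanUniformization τ := by
  obtain ⟨c, hc⟩ := exists_nonlinearity_eq_const hσ
  by_cases hc0 : c = 0
  · exact eq_euclideanUniformization_of_nonlinearity_eq_zero hσ (hc0 ▸ hc)
  exfalso
  obtain ⟨e, he, hz⟩ := σ.cover (proj τ 0)
  -- At the fixed point `0` a single chart serves for both source and target, so the same `α` and
  -- `β` occur on both sides.
  have hf0 : f (proj τ 0) = proj τ 0 := by rw [hfa, mul_zero]
  obtain ⟨A, B, C, D, hdet, h⟩ := exists_moebius_of_mem_moeb hf he he hz (by rwa [hf0])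
  obtain ⟨α, hα, β, hαβ⟩ := eventually_eq_exp_of_logDeriv_eq hc0
    (analyticAt_comp_proj (hσ he) hz) (deriv_comp_proj_ne_zero (hσ he) hz)
    ((eventually_nonlinearity_eq he hz).mono fun w hw => hw.symm.trans (hc w))
  have hcont : Tendsto (fun w : ℂ => a * w) (𝓝 0) (𝓝 0) :=
    Continuous.tendsto' (by fun_prop) _ _ (mul_zero a)
  refine false_of_moebius_exp (β := β) ha ha1 ha2 hc0 hα hdet ?_
  filter_upwards [eventually_nhds_proj.1 h, hαβ, hcont.eventually hαβ] with w hw hw1 hw2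
  rwa [hfa, hw1, hw2] at hw

end Uniqueness

end Unif

end

theorem mainTheorem6 (τ : UpperHalfPlane) :
    List.TFAE [
      -- the class of `τ` modulo `SL₂(ℤ)` is that of `exp (2πi/3)` or of `exp (iπ/2)`
      ∃ γ : Matrix.SpecialLinearGroup (Fin 2) ℤ,
        ((γ • τ : UpperHalfPlane) : ℂ) = Complex.exp (2 * Real.pi * Complex.I / 3) ∨
        ((γ • τ : UpperHalfPlane) : ℂ) = Complex.exp (Complex.I * Real.pi / 2),
      -- the Euclidean uniformization is the unique relatively Hurwitz structure in `𝒜(X_τ)`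
      Unif.euclideanUniformization τ ∈ Unif.affineStructures (Unif.Torus τ) ∧
        Unif.IsRelativelyHurwitz (Unif.toProjective (Unif.euclideanUniformization τ)) ∧
        ∀ σ ∈ Unif.affineStructures (Unif.Torus τ),
          Unif.IsRelativelyHurwitz (Unif.toProjective σ) → σ = Unif.euclideanUniformization τ,
      -- `X_τ` has complex multiplication by an automorphism other than `z ↦ ± z`
      ∃ f ∈ Unif.holAut (Unif.Torus τ), ∃ a : ℂ, a ≠ 1 ∧ a ≠ -1 ∧
        ∀ z : ℂ, f (Unif.proj τ z) = Unif.proj τ (a * z)] := by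
  have h13 := (Unif.exists_smul_eq_iff_exists_stabilizer τ).trans
    (Unif.exists_stabilizer_iff_exists_unit τ)
  tfae_have 1 → 3 := by
    intro h
    obtain ⟨a, h0, h1, h2, h, h'⟩ := h13.1 h
    obtain ⟨f, hf, hfa⟩ := Unif.exists_mem_holAut_of_unit h0 h h'
    exact ⟨f, hf, a, h1, h2, hfa⟩
  tfae_have 3 → 2 := by
    rintro ⟨f, hf, a, h1, h2, hfa⟩
    have h0 := (Unif.mul_mem_lattice_of_lift (b := 0) (by simpa using hfa)).1
    refine ⟨Unif.euclideanUniformization_mem_affineStructures τ,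
      Unif.isRelativelyHurwitz_euclideanUniformization τ, fun σ hσ hrel => ?_⟩
    exact Unif.eq_euclideanUniformization_of_mem_moeb hσ (hrel.symm ▸ hf) h0 h1 h2 hfa
  tfae_have 2 → 1 := by
    rintro ⟨-, -, h⟩
    -- Without a unit other than `±1`, the structure developed by `exp` violates uniqueness.
    by_contra hne
    rw [h13] at hne
    exact Unif.expStructure_ne τ (h _ (Unif.expStructure_mem_affineStructures τ)
      (Unif.isRelativelyHurwitz_expStructure hne))
  tfae_finish
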